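/- **Setting.** Let $P$ be a probability distribution on a measurable space $\Xi$, let $f:\mathbb R^d\times\Xi\to\mathbb R$ be a per-sample loss with $f(x,\cdot)$ $P$-integrable for every $x$, differentiable in $x$ (at every $x$, for $P$-almost every $\xi$) with jointly measurable gradient $\nabla f(x,\xi)$, and let $F(x)=\mathbb E_{\xi\sim P}[f(x,\xi)]$. Assume: 1. $F$ is differentiable and $L$-smooth, $L>0$: $\|\nabla F(x)-\nabla F(y)\|\le L\|x-y\|$ for all $x,y\in\mathbb R^d$ (Euclidean norm); and $F\ge F_{\min}$ on $\mathbb R^d$ for some $F_{\min}\in\mathbb R$. 2. For every fixed $x$ the gradient noise $\nu_\xi(x)=\nabla f(x,\xi)-\nabla F(x)$, $\xi\sim P$, is absolutely continuous with respect to Lebesgue measure, $\nu_\xi(x)$ and $-\nu_\xi(x)$ have the same distribution, and $\sup_x\mathbb E\|\nu_\xi(x)\|^p\le\sigma^p$ for some $\sigma>0$ and $p\in(1,2]$. **Algorithm (R-SGD-Mini).** Let $M,R\ge1$ be integers and $x^0\in\mathbb R^d$. At each iteration $t=0,1,2,\dots$ draw $K=MR$ samples $\xi^t_{j,k}$ ($1\le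 j\le M$, $1\le k\le R$) from $P$, all samples over all iterations being independent. Put $g^t_j(x)=\frac1R\sum_{k=1}^R\nabla f(x,\xi^t_{j,k})$, let $$j^\star=\operatorname*{argmin}_{1\le j\le M}\ \sum_{i=1}^M\|g^t_i(x^t)-g^t_j(x^t)\|$$ (ties being broken by any fixed measurable rule that depends only on the $M$ values being minimized, e.g. smallest index), and set $x^{t+1}=x^t-\alpha\, g^t_{j^\star}(x^t)$. **Theorem.** Let $\gamma\in(0,\tfrac12)$, $\theta\in(0,1)$, $M>\frac{2}{p\theta\gamma}$, and $$B=\left(\frac{\sigma\big((3-2\gamma)M+3\big)}{R^{\frac{p-1}{p}}\,(1-2\gamma)M\,\big((1-\gamma)^{1-\gamma}\gamma^{\gamma}\big)^{\frac{1}{(1-\theta)p\gamma}}}\right)^{2}\left(1+\frac{2}{p\theta\gamma M-2}\right).$$ (i) If $0<\alpha\le\frac1{2L}$, then $\mathbb E\|\nabla F(x^t)\|^2<\infty$ for all $t$, and for every integer $T\ge1$ $$\frac1T\sum_{t=0}^{T}\mathbb E\|\nabla F(x^t)\|^2\le\frac{2\big(F(x^0)-F_{\min}\big)}{\alpha T}+2L\alpha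 B .$$ In particular, if $F\ge0$, one may take $F_{\min}=0$, and the first term on the right is $\frac{2F(x^0)}{\alpha T}$. (ii) If for each horizon $T$ the algorithm is run with $\alpha=a\,T^{-1/2}$, where $a>0$ is fixed, then $$\frac1T\sum_{t=0}^{T}\mathbb E\|\nabla F(x^t)\|^2=\mathcal O\big(T^{-1/2}\big)\qquad(T\to\infty).$$ -/

import Mathlib

open MeasureTheory ProbabilityTheory

noncomputable section

namespace RSGDMini

variable {d : ℕ} {Ξ Ω : Type*} [MeasurableSpace Ξ] [MeasurableSpace Ω]

/-- The population loss `F x = 𝔼_ξ [f (x, ξ)]`, where `P` is the data distribution. -/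
def populationLoss (f : EuclideanSpace ℝ (Fin d) → Ξ → ℝ) (P : Measure Ξ)
    (x : EuclideanSpace ℝ (Fin d)) : ℝ :=
  ∫ ξ, f x ξ ∂P

/-- The per-point stochastic gradient `∇f (x, ξ)`, the gradient being taken in `x`. -/
def sampleGrad {Ξ : Type*} (f : EuclideanSpace ℝ (Fin d) → Ξ → ℝ)
    (x : EuclideanSpace ℝ (Fin d)) (ξ : Ξ) : EuclideanSpace ℝ (Fin d) :=
  gradient (fun y => f y ξ) x

/-- The per-point gradient noise `ν_ξ (x) = ∇f (x, ξ) - ∇F (x)`. -/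
def gradNoise (f : EuclideanSpace ℝ (Fin d) → Ξ → ℝ) (P : Measure Ξ)
    (x : EuclideanSpace ℝ (Fin d)) (ξ : Ξ) : EuclideanSpace ℝ (Fin d) :=
  sampleGrad f x ξ - gradient (populationLoss f P) x

/-- What makes the problem well posed: the expectation defining `F` exists, the gradient of the
per-point loss at each point exists almost surely, and it is jointly measurable. -/
structure IsStochasticLoss (f : EuclideanSpace ℝ (Fin d) → Ξ → ℝ) (P : Measure Ξ) : Prop where
  integrable : ∀ x, Integrable (f x) P
  differentiableAt : ∀ x, ∀ᵐ ξ ∂P, DifferentiableAt ℝ (fun y => f y ξ) x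
  measurable_grad : Measurable fun z : EuclideanSpace ℝ (Fin d) × Ξ => sampleGrad f z.1 z.2

/-- `F` is differentiable and its gradient is `L`-Lipschitz. -/
structure IsLSmooth (L : ℝ) (F : EuclideanSpace ℝ (Fin d) → ℝ) : Prop where
  differentiable : Differentiable ℝ F
  lipschitz : ∀ x y, ‖gradient F x - gradient F y‖ ≤ L * ‖x - y‖

/-- For every fixed `x` the per-point gradient noise is absolutely continuous, symmetric, and
has `p`-th absolute moment at most `σ ^ p`. -/
structure NoiseAssumption (f : EuclideanSpace ℝ (Fin d) → Ξ → ℝ) (P : Measure Ξ)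
    (σ p : ℝ) : Prop where
  absolutelyContinuous : ∀ x, P.map (gradNoise f P x) ≪ volume
  symmetric : ∀ x, P.map (gradNoise f P x) = P.map (fun ξ => -gradNoise f P x ξ)
  integrable_moment : ∀ x, Integrable (fun ξ => ‖gradNoise f P x ξ‖ ^ p) P
  moment_le : ∀ x, ∫ ξ, ‖gradNoise f P x ξ‖ ^ p ∂P ≤ σ ^ p

/-- `ξ t j k` is the `k`-th data point of the `j`-th chunk drawn at iteration `t`. All the
data points, over all iterations, are independent with law `P`. -/
structure IsIIDSample {M R : ℕ} (ξ : ℕ → Fin M → Fin R → Ω → Ξ) (P : Measure Ξ)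
    (μ : Measure Ω) : Prop where
  measurable : ∀ t j k, Measurable (ξ t j k)
  law : ∀ t j k, μ.map (ξ t j k) = P
  indep : iIndepFun (fun (i : ℕ × Fin M × Fin R) => ξ i.1 i.2.1 i.2.2) μ

/-- A (measurable) rule `argmin` that maps `v = (v_1, …, v_M)` to an index minimizing `v_j`.
It fixes how ties are broken, e.g. in favour of the smallest index. -/
structure IsArgminRule {M : ℕ} (argmin : (Fin M → ℝ) → Fin M) : Prop where
  measurable : Measurable argmin
  le : ∀ (v : Fin M → ℝ) (j : Fin M), v (argmin v) ≤ v j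

/-- The index `j⋆ = argmin_j ∑_i ‖a_i - a_j‖` of the medoid of `a_1, …, a_M`. -/
def medoidIndex {M : ℕ} (argmin : (Fin M → ℝ) → Fin M)
    (a : Fin M → EuclideanSpace ℝ (Fin d)) : Fin M :=
  argmin fun j => ∑ i, ‖a i - a j‖

/-- The stochastic gradient `(1/R) ∑_k ∇f (x, z_k)` of a chunk `z_1, …, z_R` of data points. -/
def chunkGrad {Ξ : Type*} {R : ℕ} (f : EuclideanSpace ℝ (Fin d) → Ξ → ℝ)
    (z : Fin R → Ξ) (x : EuclideanSpace ℝ (Fin d)) : EuclideanSpace ℝ (Fin d) :=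
  (R : ℝ)⁻¹ • ∑ k, sampleGrad f x (z k)

/-- One step `x ↦ x - α ∇f_{j⋆} (x)` on a batch of `M` chunks of `R` data points each. -/
def step {Ξ : Type*} {M R : ℕ} (f : EuclideanSpace ℝ (Fin d) → Ξ → ℝ)
    (argmin : (Fin M → ℝ) → Fin M) (α : ℝ) (batch : Fin M → Fin R → Ξ)
    (x : EuclideanSpace ℝ (Fin d)) : EuclideanSpace ℝ (Fin d) :=
  x - α • chunkGrad f (batch (medoidIndex argmin fun j => chunkGrad f (batch j) x)) x

/-- The iterates `x^0, x^1, …` of R-SGD-Mini. -/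
def iterate {Ξ Ω : Type*} {M R : ℕ} (f : EuclideanSpace ℝ (Fin d) → Ξ → ℝ)
    (argmin : (Fin M → ℝ) → Fin M) (ξ : ℕ → Fin M → Fin R → Ω → Ξ)
    (x₀ : EuclideanSpace ℝ (Fin d)) (α : ℝ) : ℕ → Ω → EuclideanSpace ℝ (Fin d)
  | 0, _ => x₀
  | t + 1, ω => step f argmin α (fun j k => ξ t j k ω) (iterate f argmin ξ x₀ α t ω)

/-- The bound `B` on the second moment of the medoid noise. -/
def momentBound (σ p γ θ : ℝ) (M R : ℕ) : ℝ :=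
  (σ * ((3 - 2 * γ) * M + 3) /
      ((R : ℝ) ^ ((p - 1) / p) * ((1 - 2 * γ) * M) *
        ((1 - γ) ^ (1 - γ) * γ ^ γ) ^ (1 / ((1 - θ) * p * γ)))) ^ 2 *
    (1 + 2 / (p * θ * γ * M - 2))

end RSGDMini

end

/-! The medoid depends on its input only through pairwise distances. It is therefore translation
equivariant, so a step is a gradient step on $F$ perturbed by the medoid of the averaged noises. It
is also odd, so for symmetric noise this perturbation has mean zero. Once its second moment is
bounded by $B$ uniformly in $x$, the classical analysis of unbiased SGD applies, although the raw
noise has only $p\le2$ moments.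

The second moment comes from three facts. Averaging $R$ independent symmetric vectors turns $\sigma$
into $\sigma/R^{(p-1)/p}$ with no constant lost (`lintegral_enorm_sum_rpow_le_of_symm`). A medoid of
norm $Cu$, with $C=(3-2\gamma)/(1-2\gamma)$, forces more than $\gamma M$ of the vectors to have norm
at least $u$ (`norm_medoid_lt`). Hence with $k=\lfloor\gamma M\rfloor+1$ the $pk$-th power of the
medoid norm is controlled by products of $k$ distinct factors $\|a_j\|^p$, whose expectations factor
by independence. Counting $k$-subsets by an entropy bound and passing from $L^{pk}$ to $L^2$ (as
$pk\ge2$) gives a bound below $B$ (`lintegral_enorm_medoid_sq_le_momentBound`).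

For the dynamics, $x^t$ is independent of the batch drawn at time $t$, so by Fubini the cross term
in the smoothness inequality vanishes, and the descent inequality telescopes. -/

open MeasureTheory ProbabilityTheory
open scoped ENNReal

noncomputable section

namespace RSGDMini

/-! ### Moments of sums of independent symmetric vectors -/

section IndependentSums

variable {V : Type*} [NormedAddCommGroup V] [InnerProductSpace ℝ V]

/-- Clarkson's inequality for exponents at most two in an inner product space. -/
theorem norm_add_rpow_add_norm_sub_rpow_le {p : ℝ} (hp0 : 0 ≤ p) (hp2 : p ≤ 2) (a b : V) :
    ‖a + b‖ ^ p + ‖a - b‖ ^ p ≤ 2 * (‖a‖ ^ p + ‖b‖ ^ p) := by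
  have hsq : ∀ x : V, ‖x‖ ^ p = (‖x‖ ^ 2) ^ (p / 2) := fun x => by
    rw [← Real.rpow_natCast, ← Real.rpow_mul (norm_nonneg _)]
    congr 1
    push_cast
    ring
  have hpar : 2⁻¹ * ‖a + b‖ ^ 2 + 2⁻¹ * ‖a - b‖ ^ 2 = ‖a‖ ^ 2 + ‖b‖ ^ 2 := by
    have := parallelogram_law_with_norm ℝ a b
    linarith [sq ‖a + b‖, sq ‖a - b‖, sq ‖a‖, sq ‖b‖]
  -- Midpoint concavity of $s\mapsto s^{p/2}$, applied to the parallelogram law, bounds the left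
  -- side by $2(\|a\|^2+\|b\|^2)^{p/2}$; subadditivity of the same function finishes.
  have hconc := (Real.concaveOn_rpow (p := p / 2) (by linarith) (by linarith)).2
    (Set.mem_Ici.2 (sq_nonneg ‖a + b‖)) (Set.mem_Ici.2 (sq_nonneg ‖a - b‖))
    (inv_nonneg.2 zero_le_two) (inv_nonneg.2 zero_le_two) (by norm_num : (2 : ℝ)⁻¹ + 2⁻¹ = 1)
  simp only [smul_eq_mul] at hconc
  rw [hpar] at hconc
  have hsub := Real.rpow_add_le_add_rpow (p := p / 2) (sq_nonneg ‖a‖) (sq_nonneg ‖b‖)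
    (by linarith) (by linarith)
  rw [hsq, hsq, hsq a, hsq b]
  linarith

theorem enorm_add_rpow_add_enorm_sub_rpow_le {p : ℝ} (hp0 : 0 ≤ p) (hp2 : p ≤ 2) (a b : V) :
    ‖a + b‖ₑ ^ p + ‖a - b‖ₑ ^ p ≤ 2 * (‖a‖ₑ ^ p + ‖b‖ₑ ^ p) := by
  have h : ∀ x : V, ‖x‖ₑ ^ p = ENNReal.ofReal (‖x‖ ^ p) := fun x => by
    rw [← ofReal_norm, ENNReal.ofReal_rpow_of_nonneg (norm_nonneg _) hp0]
  have h2 : (2 : ℝ≥0∞) = ENNReal.ofReal 2 := by simp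
  rw [h, h, h, h, ← ENNReal.ofReal_add (by positivity) (by positivity),
    ← ENNReal.ofReal_add (by positivity) (by positivity), h2, ← ENNReal.ofReal_mul (by norm_num)]
  exact ENNReal.ofReal_le_ofReal (norm_add_rpow_add_norm_sub_rpow_le hp0 hp2 a b)

variable [MeasurableSpace V] [BorelSpace V] [SecondCountableTopology V]
  {Ω : Type*} [MeasurableSpace Ω] {μ : Measure Ω}

/-- Independence and symmetry of $Y$ make $(X,Y)$ and $(X,-Y)$ equal in law, so $X+Y$ and $X-Y$ have
the same $p$-th moment. Integrating Clarkson's inequality then gives twice the claim. Only the added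
summand has to be symmetric, which suits the induction on sums. -/
theorem lintegral_enorm_add_rpow_le_of_symm [IsFiniteMeasure μ] {p : ℝ} (hp0 : 0 ≤ p)
    (hp2 : p ≤ 2) {X Y : Ω → V} (hX : Measurable X) (hY : Measurable Y) (hXY : IndepFun X Y μ)
    (hsymm : μ.map Y = μ.map (fun ω => -Y ω)) :
    ∫⁻ ω, ‖X ω + Y ω‖ₑ ^ p ∂μ ≤ ∫⁻ ω, ‖X ω‖ₑ ^ p ∂μ + ∫⁻ ω, ‖Y ω‖ₑ ^ p ∂μ := by
  have hlaw : μ.map (fun ω => (X ω, Y ω)) = μ.map (fun ω => (X ω, -Y ω)) := by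
    rw [(indepFun_iff_map_prod_eq_prod_map_map hX.aemeasurable hY.aemeasurable).1 hXY,
      (indepFun_iff_map_prod_eq_prod_map_map (g := fun ω => -Y ω) hX.aemeasurable
        hY.neg.aemeasurable).1 (hXY.comp measurable_id measurable_neg), hsymm]
  have hmeas : Measurable fun z : V × V => ‖z.1 + z.2‖ₑ ^ p := by fun_prop
  have heq : ∫⁻ ω, ‖X ω + Y ω‖ₑ ^ p ∂μ = ∫⁻ ω, ‖X ω - Y ω‖ₑ ^ p ∂μ := by
    have h1 := lintegral_map (μ := μ) hmeas (hX.prodMk hY)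
    have h2 := lintegral_map (μ := μ) hmeas (hX.prodMk hY.neg)
    simp only [Pi.neg_apply] at h2
    rw [hlaw, h2] at h1
    simpa [sub_eq_add_neg] using h1.symm
  have htwo : 2 * ∫⁻ ω, ‖X ω + Y ω‖ₑ ^ p ∂μ
      ≤ 2 * (∫⁻ ω, ‖X ω‖ₑ ^ p ∂μ + ∫⁻ ω, ‖Y ω‖ₑ ^ p ∂μ) := by
    calc 2 * ∫⁻ ω, ‖X ω + Y ω‖ₑ ^ p ∂μ
        = ∫⁻ ω, ‖X ω + Y ω‖ₑ ^ p + ‖X ω - Y ω‖ₑ ^ p ∂μ := by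
          rw [lintegral_add_left (by fun_prop), ← heq, two_mul]
      _ ≤ ∫⁻ ω, 2 * (‖X ω‖ₑ ^ p + ‖Y ω‖ₑ ^ p) ∂μ :=
          lintegral_mono fun ω => enorm_add_rpow_add_enorm_sub_rpow_le hp0 hp2 _ _
      _ = _ := by
          rw [lintegral_const_mul _ (by fun_prop), lintegral_add_left (by fun_prop)]
  exact (ENNReal.mul_le_mul_iff_right (by simp) (by simp)).1 htwo

/-- A von Bahr–Esseen inequality: the `p`-th moment is subadditive along independent symmetric
summands. -/
theorem lintegral_enorm_sum_rpow_le_of_symm [IsFiniteMeasure μ] {ι : Type*} {p : ℝ}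
    (hp0 : 0 < p) (hp2 : p ≤ 2) {Y : ι → Ω → V} (hY : ∀ i, Measurable (Y i))
    (hindep : iIndepFun Y μ) (hsymm : ∀ i, μ.map (Y i) = μ.map (fun ω => -Y i ω))
    (s : Finset ι) :
    ∫⁻ ω, ‖∑ i ∈ s, Y i ω‖ₑ ^ p ∂μ ≤ ∑ i ∈ s, ∫⁻ ω, ‖Y i ω‖ₑ ^ p ∂μ := by
  classical
  induction s using Finset.induction_on with
  | empty => simp [hp0]
  | insert i s his ih =>
    have hind : IndepFun (fun ω => ∑ j ∈ s, Y j ω) (Y i) μ := by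
      have := hindep.indepFun_finsetSum_of_notMem hY his
      have he : (fun ω => ∑ j ∈ s, Y j ω) = ∑ j ∈ s, Y j := by ext; simp
      rwa [he]
    have h := lintegral_enorm_add_rpow_le_of_symm hp0.le hp2
      (Finset.measurable_fun_sum s fun j _ => hY j) (hY i) hind (hsymm i)
    simp only [Finset.sum_insert his]
    simp only [add_comm (Y i _)]
    rw [add_comm (∫⁻ ω, ‖Y i ω‖ₑ ^ p ∂μ)]
    exact h.trans (by gcongr)

end IndependentSums

/-! ### Deterministic properties of the medoid -/

section Medoid

variable {d M : ℕ}

/-- The medoid of `a_1, …, a_M`, i.e. the vector with the index `medoidIndex argmin a`. -/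
def medoid (argmin : (Fin M → ℝ) → Fin M) (a : Fin M → EuclideanSpace ℝ (Fin d)) :
    EuclideanSpace ℝ (Fin d) :=
  a (medoidIndex argmin a)

theorem medoidIndex_add_const (argmin : (Fin M → ℝ) → Fin M)
    (a : Fin M → EuclideanSpace ℝ (Fin d)) (c : EuclideanSpace ℝ (Fin d)) :
    medoidIndex argmin (fun j => a j + c) = medoidIndex argmin a := by
  simp [medoidIndex]

/-- Negation preserves all pairwise distances, hence every minimized value. The tie-breaking rule
sees only these values, so the same index is chosen even when there are ties. -/
theorem medoid_neg (argmin : (Fin M → ℝ) → Fin M) (a : Fin M → EuclideanSpace ℝ (Fin d)) :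
    medoid argmin (-a) = -medoid argmin a := by
  have h : ∀ i j, ‖-a i + a j‖ = ‖a i - a j‖ := fun i j => by
    rw [norm_sub_rev, neg_add_eq_sub]
  simp [medoid, medoidIndex, h]

theorem measurable_medoidIndex {argmin : (Fin M → ℝ) → Fin M} (hargmin : IsArgminRule argmin) :
    Measurable (medoidIndex (d := d) argmin) := by
  refine hargmin.measurable.comp (measurable_pi_lambda _ fun j => ?_)
  fun_prop

theorem measurable_medoid {argmin : (Fin M → ℝ) → Fin M} (hargmin : IsArgminRule argmin) :
    Measurable (medoid (d := d) argmin) := by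
  have h : Measurable fun z : (Fin M → EuclideanSpace ℝ (Fin d)) × Fin M => z.1 z.2 :=
    measurable_from_prod_countable_left fun j => measurable_pi_apply j
  exact h.comp (measurable_id.prodMk (measurable_medoidIndex hargmin))

/-- The medoid, of norm $D$, is compared with a vector $a_k$ of norm below $u$. In the difference of
the two objectives, each of the $b$ long vectors contributes at most $u+D$ and each of the $g$ short
ones less than $3u-D$. Optimality makes the total nonnegative, so $(g-b)D<(3g+b)u$; the worst case
$b=\gamma M$ gives the constant. -/
theorem norm_medoid_lt {argmin : (Fin M → ℝ) → Fin M} (hargmin : IsArgminRule argmin)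
    {γ : ℝ} (hγ : γ < 1 / 2) (hM : 0 < M) (a : Fin M → EuclideanSpace ℝ (Fin d)) {u : ℝ}
    (hcard : ((Finset.univ.filter fun j => u ≤ ‖a j‖).card : ℝ) ≤ γ * M) :
    ‖medoid argmin a‖ < (3 - 2 * γ) / (1 - 2 * γ) * u := by
  have hM' : (0 : ℝ) < M := by exact_mod_cast hM
  set D := ‖medoid argmin a‖ with hD
  set Bad := Finset.univ.filter fun j => u ≤ ‖a j‖ with hBad
  set Good := Finset.univ.filter fun j => ¬ u ≤ ‖a j‖ with hGood
  have hsum : (Bad.card : ℝ) + Good.card = M := by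
    have := Finset.card_filter_add_card_filter_not (s := (Finset.univ : Finset (Fin M)))
      (fun j => u ≤ ‖a j‖)
    simp only [Finset.card_univ, Fintype.card_fin] at this
    exact_mod_cast this
  have hgoodpos : (0 : ℝ) < Good.card := by nlinarith
  obtain ⟨k, hk⟩ : Good.Nonempty := Finset.card_pos.1 (by exact_mod_cast hgoodpos)
  have hk' : ‖a k‖ < u := by simpa [hGood] using hk
  have hmin : ∑ i, ‖a i - medoid argmin a‖ ≤ ∑ i, ‖a i - a k‖ :=
    hargmin.le (fun j => ∑ i, ‖a i - a j‖) k
  have hdiff : 0 ≤ ∑ i, (‖a i - a k‖ - ‖a i - medoid argmin a‖) := by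
    rw [Finset.sum_sub_distrib]
    linarith
  rw [← Finset.sum_filter_add_sum_filter_not _ fun j => u ≤ ‖a j‖] at hdiff
  have hb : ∑ i ∈ Bad, (‖a i - a k‖ - ‖a i - medoid argmin a‖) ≤ Bad.card * (u + D) := by
    rw [← nsmul_eq_mul]
    refine Finset.sum_le_card_nsmul _ _ _ fun i _ => ?_
    have h1 := norm_sub_le_norm_sub_add_norm_sub (a i) (medoid argmin a) (a k)
    have h2 := norm_sub_le (medoid argmin a) (a k)
    linarith
  have hg : ∑ i ∈ Good, (‖a i - a k‖ - ‖a i - medoid argmin a‖) < Good.card * (3 * u - D) := by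
    rw [← nsmul_eq_mul, ← Finset.sum_const]
    refine Finset.sum_lt_sum_of_nonempty ⟨k, hk⟩ fun i hi => ?_
    have hi' : ‖a i‖ < u := by simpa [hGood] using hi
    have h1 := norm_sub_le (a i) (a k)
    have h2 : D - ‖a i‖ ≤ ‖a i - medoid argmin a‖ := by
      rw [norm_sub_rev]
      exact norm_sub_norm_le _ _
    linarith
  have hkey : (Good.card - Bad.card : ℝ) * D < (3 * Good.card + Bad.card) * u := by
    nlinarith [hdiff.trans_lt (add_lt_add_of_le_of_lt hb hg)]
  rw [div_mul_eq_mul_div, lt_div_iff₀ (by linarith)]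
  have hG : (Good.card : ℝ) = M - Bad.card := by linarith
  rw [hG] at hkey
  by_contra! hcon
  -- With $g=M-b$ the inequality reads $M(D-3u)<2b(D-u)$. Since $D\ge u$, its right side grows with
  -- $b$, so $b$ may be replaced by $\gamma M$.
  have hDu : u ≤ D := by
    have hD0 : 0 ≤ D := norm_nonneg _
    nlinarith
  nlinarith [mul_nonneg (sub_nonneg.2 hcard) (sub_nonneg.2 hDu), mul_le_mul_of_nonneg_left hcon hM'.le]

/-- With $u=\|\mathrm{medoid}\|/C$, at least $k$ vectors have norm $\ge u$, so some $k$-subset has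
product at least $u^{pk}$; the sum over all $k$-subsets dominates it. Each factor carries only the
power $p$, so a $pk$-th moment is obtained from $p$-th moments alone. -/
theorem enorm_medoid_rpow_le {argmin : (Fin M → ℝ) → Fin M} (hargmin : IsArgminRule argmin)
    {γ : ℝ} (hγ0 : 0 < γ) (hγ : γ < 1 / 2) (hM : 0 < M) {p : ℝ} (hp : 0 < p)
    (a : Fin M → EuclideanSpace ℝ (Fin d)) :
    ‖medoid argmin a‖ₑ ^ (p * (⌊γ * M⌋₊ + 1 : ℕ)) ≤
      ENNReal.ofReal ((3 - 2 * γ) / (1 - 2 * γ)) ^ (p * (⌊γ * M⌋₊ + 1 : ℕ)) *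
        ∑ s ∈ Finset.univ.powersetCard (⌊γ * M⌋₊ + 1), ∏ j ∈ s, ‖a j‖ₑ ^ p := by
  -- The least integer strictly above $\gamma M$: fewer than $k$ long vectors means at most $\gamma
  -- M$ of them.
  set k := ⌊γ * M⌋₊ + 1 with hk
  set C := (3 - 2 * γ) / (1 - 2 * γ) with hC
  have hCpos : 0 < C := div_pos (by linarith) (by linarith)
  set u := ‖medoid argmin a‖ / C with hu
  have hcard : k ≤ (Finset.univ.filter fun j => u ≤ ‖a j‖).card := by
    by_contra! hlt
    have hle : ((Finset.univ.filter fun j => u ≤ ‖a j‖).card : ℝ) ≤ γ * M :=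
      (Nat.cast_le.2 (Nat.lt_succ_iff.1 hlt)).trans (Nat.floor_le (by positivity))
    have := norm_medoid_lt hargmin hγ hM a hle
    rw [← hC, hu, mul_div_cancel₀ _ hCpos.ne'] at this
    exact lt_irrefl _ this
  obtain ⟨s, hs, hsk⟩ := Finset.exists_subset_card_eq hcard
  have hD : ‖medoid argmin a‖ₑ = ENNReal.ofReal C * ENNReal.ofReal u := by
    rw [← ENNReal.ofReal_mul hCpos.le, hu, mul_div_cancel₀ _ hCpos.ne', ofReal_norm]
  have hpk : 0 ≤ p * (k : ℝ) := by positivity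
  rw [hD, ENNReal.mul_rpow_of_nonneg _ _ hpk]
  gcongr
  calc ENNReal.ofReal u ^ (p * (k : ℝ)) = ∏ j ∈ s, ENNReal.ofReal u ^ p := by
        rw [Finset.prod_const, hsk, ENNReal.rpow_mul, ENNReal.rpow_natCast]
    _ ≤ ∏ j ∈ s, ‖a j‖ₑ ^ p := by
        refine Finset.prod_le_prod' fun j hj => ?_
        have : u ≤ ‖a j‖ := (Finset.mem_filter.1 (hs hj)).2
        rw [← ofReal_norm]
        gcongr
    _ ≤ _ := Finset.single_le_sum (f := fun s : Finset (Fin M) => ∏ j ∈ s, ‖a j‖ₑ ^ p)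
        (fun _ _ => zero_le) (Finset.mem_powersetCard.2 ⟨Finset.subset_univ _, hsk⟩)

end Medoid

/-! ### Mean and second moment of the medoid of i.i.d. vectors -/

section MedoidMoment

variable {d M : ℕ}

theorem binomBase_mem {γ : ℝ} (hγ0 : 0 < γ) (hγ1 : γ < 1) :
    0 < (1 - γ) ^ (1 - γ) * γ ^ γ ∧ (1 - γ) ^ (1 - γ) * γ ^ γ ≤ 1 := by
  have h1 : 0 < 1 - γ := by linarith
  refine ⟨by positivity, mul_le_one₀ ?_ (by positivity) ?_⟩
  · exact Real.rpow_le_one h1.le (by linarith) h1.le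
  · exact Real.rpow_le_one hγ0.le hγ1.le hγ0.le

/-- A single term of the expansion of $(\gamma+(1-\gamma))^M=1$ is at most $1$. As $k\ge\gamma M$
gives $M-k\le k(1-\gamma)/\gamma$, the exponent of $1-\gamma$ can be made proportional to $k$, so
that a $pk$-th root no longer depends on $M$. -/
theorem choose_le_binomBase_rpow {γ : ℝ} (hγ0 : 0 < γ) (hγ1 : γ < 1) {k : ℕ} (hkM : k ≤ M)
    (hk : γ * M ≤ k) :
    (M.choose k : ℝ) ≤ ((1 - γ) ^ (1 - γ) * γ ^ γ) ^ (-(k / γ)) := by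
  have h1 : 0 < 1 - γ := by linarith
  have hterm : γ ^ k * (1 - γ) ^ (M - k) * (M.choose k : ℝ) ≤ 1 := by
    have h := add_pow γ (1 - γ) M
    rw [add_sub_cancel, one_pow] at h
    exact (Finset.single_le_sum (f := fun i => γ ^ i * (1 - γ) ^ (M - i) * (M.choose i : ℝ))
      (fun i _ => by positivity) (Finset.mem_range.2 (Nat.lt_succ_of_le hkM))).trans_eq h.symm
  have hbase : ((1 - γ) ^ (1 - γ) * γ ^ γ) ^ ((k : ℝ) / γ) ≤ γ ^ k * (1 - γ) ^ (M - k) := by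
    rw [Real.mul_rpow (by positivity) (by positivity), ← Real.rpow_mul h1.le,
      ← Real.rpow_mul hγ0.le, mul_div_cancel₀ _ hγ0.ne', Real.rpow_natCast, mul_comm]
    gcongr
    rw [← Real.rpow_natCast (1 - γ) (M - k)]
    refine Real.rpow_le_rpow_of_exponent_ge h1 (by linarith) ?_
    rw [Nat.cast_sub hkM, mul_div_assoc', le_div_iff₀ hγ0]
    linarith
  have hpos : 0 < ((1 - γ) ^ (1 - γ) * γ ^ γ) ^ ((k : ℝ) / γ) :=
    Real.rpow_pos_of_pos (binomBase_mem hγ0 hγ1).1 _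
  rw [Real.rpow_neg (binomBase_mem hγ0 hγ1).1.le, ← one_div, le_div_iff₀ hpos, mul_comm]
  exact (mul_le_mul_of_nonneg_right hbase (Nat.cast_nonneg _)).trans hterm

theorem lintegral_prod_enorm_rpow_le (ρ : Measure (EuclideanSpace ℝ (Fin d)))
    [IsProbabilityMeasure ρ] {p : ℝ} {m : ℝ≥0∞} (hρ : ∫⁻ a, ‖a‖ₑ ^ p ∂ρ ≤ m)
    (s : Finset (Fin M)) :
    ∫⁻ a, ∏ j ∈ s, ‖a j‖ₑ ^ p ∂(Measure.pi fun _ : Fin M => ρ) ≤ m ^ s.card := by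
  have hmeas : Measurable fun v : EuclideanSpace ℝ (Fin d) => ‖v‖ₑ ^ p := by fun_prop
  have hind : iIndepFun (fun (j : Fin M) (a : Fin M → EuclideanSpace ℝ (Fin d)) => ‖a j‖ₑ ^ p)
      (Measure.pi fun _ : Fin M => ρ) :=
    iIndepFun_pi (X := fun _ v => ‖v‖ₑ ^ p) fun _ => hmeas.aemeasurable
  rw [lintegral_prod_eq_prod_lintegral_of_indepFun s _ hind fun j => by fun_prop]
  refine (Finset.prod_le_prod' fun j _ => ?_).trans_eq (Finset.prod_const m)
  rwa [(measurePreserving_eval (fun _ : Fin M => ρ) j).lintegral_comp hmeas]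

theorem lintegral_enorm_medoid_rpow_le {argmin : (Fin M → ℝ) → Fin M}
    (hargmin : IsArgminRule argmin) {γ : ℝ} (hγ0 : 0 < γ) (hγ : γ < 1 / 2) (hM : 0 < M)
    {p : ℝ} (hp : 0 < p) (ρ : Measure (EuclideanSpace ℝ (Fin d))) [IsProbabilityMeasure ρ]
    {m : ℝ≥0∞} (hρ : ∫⁻ a, ‖a‖ₑ ^ p ∂ρ ≤ m) :
    ∫⁻ a, ‖medoid argmin a‖ₑ ^ (p * (⌊γ * M⌋₊ + 1 : ℕ)) ∂(Measure.pi fun _ : Fin M => ρ) ≤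
      ENNReal.ofReal ((3 - 2 * γ) / (1 - 2 * γ)) ^ (p * (⌊γ * M⌋₊ + 1 : ℕ)) *
        (M.choose (⌊γ * M⌋₊ + 1) * m ^ (⌊γ * M⌋₊ + 1)) := by
  refine (lintegral_mono fun a => enorm_medoid_rpow_le hargmin hγ0 hγ hM hp a).trans ?_
  rw [lintegral_const_mul _ (by fun_prop), lintegral_finsetSum _ (fun s _ => by fun_prop)]
  gcongr
  refine (Finset.sum_le_card_nsmul _ _ (m ^ (⌊γ * M⌋₊ + 1)) fun s hs => ?_).trans_eq ?_
  · rw [← (Finset.mem_powersetCard.1 hs).2]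
    exact lintegral_prod_enorm_rpow_le ρ hρ s
  · simp [nsmul_eq_mul]

/-- Since $k\ge\gamma M$ and $p\gamma M>2$, the exponent $pk$ is at least $2$, and on a probability
space the $L^2$ norm is at most the $L^{pk}$ norm. The $pk$-th root turns $\binom Mk$ into at most
$c^{-1/(p\gamma)}$, $c=(1-\gamma)^{1-\gamma}\gamma^\gamma$, and $(s^p)^k$ into $s$. -/
theorem lintegral_enorm_medoid_sq_le {argmin : (Fin M → ℝ) → Fin M}
    (hargmin : IsArgminRule argmin) {γ : ℝ} (hγ0 : 0 < γ) (hγ : γ < 1 / 2)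
    {p : ℝ} (hp : 0 < p) (hM : 2 < p * γ * M) {s : ℝ} (hs : 0 ≤ s)
    (ρ : Measure (EuclideanSpace ℝ (Fin d))) [IsProbabilityMeasure ρ]
    (hρ : ∫⁻ a, ‖a‖ₑ ^ p ∂ρ ≤ ENNReal.ofReal s ^ p) :
    ∫⁻ a, ‖medoid argmin a‖ₑ ^ 2 ∂(Measure.pi fun _ : Fin M => ρ) ≤
      ENNReal.ofReal (((3 - 2 * γ) / (1 - 2 * γ) * s *
        ((1 - γ) ^ (1 - γ) * γ ^ γ) ^ (-(1 / (p * γ)))) ^ 2) := by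
  have hM0 : 0 < M := by
    rcases Nat.eq_zero_or_pos M with h | h
    · rw [h, Nat.cast_zero, mul_zero] at hM
      linarith
    · exact h
  have hM' : (0 : ℝ) < M := by exact_mod_cast hM0
  have hc := (binomBase_mem hγ0 (by linarith : γ < 1)).1
  set c := (1 - γ) ^ (1 - γ) * γ ^ γ with hcdef
  set C := (3 - 2 * γ) / (1 - 2 * γ) with hC
  have hCpos : 0 < C := div_pos (by linarith) (by linarith)
  have hbound := lintegral_enorm_medoid_rpow_le hargmin hγ0 hγ hM0 hp ρ hρ
  have hkM : ⌊γ * M⌋₊ + 1 ≤ M := Nat.succ_le_of_lt <|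
    (Nat.floor_lt (by positivity)).2 (by nlinarith)
  have hk : γ * M ≤ (⌊γ * M⌋₊ + 1 : ℕ) := by
    push_cast
    exact (Nat.lt_floor_add_one _).le
  have hchoose := choose_le_binomBase_rpow hγ0 (by linarith) hkM hk
  rw [← hC] at hbound
  rw [← hcdef] at hchoose
  set k := ⌊γ * M⌋₊ + 1 with hkdef
  have hk0 : (0 : ℝ) < k := by positivity
  have hpk : 0 < p * (k : ℝ) := by positivity
  have hpk2 : 2 ≤ p * (k : ℝ) := by nlinarith
  have hchoose' : (M.choose k : ℝ≥0∞) ≤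
      ENNReal.ofReal (c ^ (-(1 / (p * γ)))) ^ (p * (k : ℝ)) := by
    rw [ENNReal.ofReal_rpow_of_nonneg (by positivity) hpk.le, ← Real.rpow_mul hc.le,
      ← ENNReal.ofReal_natCast]
    refine ENNReal.ofReal_le_ofReal (hchoose.trans_eq ?_)
    congr 1
    field_simp
  have hmain : ∫⁻ a, ‖medoid argmin a‖ₑ ^ (p * (k : ℝ)) ∂(Measure.pi fun _ : Fin M => ρ) ≤
      ENNReal.ofReal (C * s * c ^ (-(1 / (p * γ)))) ^ (p * (k : ℝ)) := by
    refine hbound.trans ?_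
    rw [ENNReal.ofReal_mul (by positivity), ENNReal.ofReal_mul hCpos.le,
      ENNReal.mul_rpow_of_nonneg _ _ hpk.le, ENNReal.mul_rpow_of_nonneg _ _ hpk.le, mul_assoc,
      mul_comm (ENNReal.ofReal s ^ _), ENNReal.rpow_mul (ENNReal.ofReal s), ENNReal.rpow_natCast]
    gcongr
  have hjensen := eLpNorm'_le_eLpNorm'_of_exponent_le (p := 2) (q := p * (k : ℝ)) two_pos hpk2
    (Measure.pi fun _ : Fin M => ρ) (measurable_medoid (d := d) hargmin).aestronglyMeasurable
  have hroot : eLpNorm' (medoid argmin) (p * (k : ℝ)) (Measure.pi fun _ : Fin M => ρ) ≤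
      ENNReal.ofReal (C * s * c ^ (-(1 / (p * γ)))) := by
    rw [eLpNorm', one_div, ENNReal.rpow_inv_le_iff hpk]
    exact hmain
  have h2 := hjensen.trans hroot
  rw [eLpNorm', one_div, ENNReal.rpow_inv_le_iff two_pos] at h2
  rw [ENNReal.ofReal_pow (by positivity)]
  simpa using h2

/-- The preceding bound is already smaller than $B$: the $+3$, the factor $1+2/(p\theta\gamma
M-2)\ge1$ and the exponent containing $1-\theta$ only enlarge it. -/
theorem lintegral_enorm_medoid_sq_le_momentBound {argmin : (Fin M → ℝ) → Fin M}
    (hargmin : IsArgminRule argmin) {σ p γ θ : ℝ} (hσ : 0 < σ) (hp : 0 < p)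
    (hγ : γ ∈ Set.Ioo (0 : ℝ) (1 / 2)) (hθ : θ ∈ Set.Ioo (0 : ℝ) 1)
    {R : ℕ} (hM : 2 / (p * θ * γ) < (M : ℝ)) (hR : 1 ≤ R)
    (ρ : Measure (EuclideanSpace ℝ (Fin d))) [IsProbabilityMeasure ρ]
    (hρ : ∫⁻ a, ‖a‖ₑ ^ p ∂ρ ≤ ENNReal.ofReal (σ / (R : ℝ) ^ ((p - 1) / p)) ^ p) :
    ∫⁻ a, ‖medoid argmin a‖ₑ ^ 2 ∂(Measure.pi fun _ : Fin M => ρ) ≤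
      ENNReal.ofReal (momentBound σ p γ θ M R) := by
  obtain ⟨hγ0, hγ1⟩ := hγ
  obtain ⟨hθ0, hθ1⟩ := hθ
  have hR0 : (0 : ℝ) < R := by exact_mod_cast hR
  have hM0 : (0 : ℝ) < M := lt_trans (by positivity) hM
  rw [div_lt_iff₀ (by positivity)] at hM
  have hM2 : 2 < p * γ * M := by
    have : 0 < p * γ * M := by positivity
    nlinarith
  refine (lintegral_enorm_medoid_sq_le hargmin hγ0 hγ1 hp hM2 (by positivity) ρ hρ).trans
    (ENNReal.ofReal_le_ofReal ?_)
  obtain ⟨hc0, hc1⟩ := binomBase_mem hγ0 (by linarith : γ < 1)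
  rw [momentBound]
  set c := (1 - γ) ^ (1 - γ) * γ ^ γ
  set r := (R : ℝ) ^ ((p - 1) / p)
  have hr : 0 < r := by positivity
  have h12 : 0 < 1 - 2 * γ := by linarith
  have h32 : 0 < 3 - 2 * γ := by linarith
  -- As $c\le1$, the larger exponent shrinks the power, which sits in the denominator of $B$.
  have hexp : c ^ (1 / ((1 - θ) * p * γ)) ≤ c ^ (1 / (p * γ)) := by
    refine Real.rpow_le_rpow_of_exponent_ge hc0 hc1 ?_
    have : 0 < 1 - θ := by linarith
    have : 0 < p * γ := by positivity
    refine one_div_le_one_div_of_le (by positivity) ?_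
    nlinarith
  have hbase : (3 - 2 * γ) / (1 - 2 * γ) * (σ / r) * c ^ (-(1 / (p * γ))) ≤
      σ * ((3 - 2 * γ) * M + 3) / (r * ((1 - 2 * γ) * M) * c ^ (1 / ((1 - θ) * p * γ))) := by
    calc (3 - 2 * γ) / (1 - 2 * γ) * (σ / r) * c ^ (-(1 / (p * γ)))
        = σ * ((3 - 2 * γ) * M) / (r * ((1 - 2 * γ) * M) * c ^ (1 / (p * γ))) := by
          rw [Real.rpow_neg hc0.le]
          field_simp
      _ ≤ _ := by
          gcongr
          linarith
  have hfac : 0 ≤ 2 / (p * θ * γ * M - 2) := div_nonneg zero_le_two (by linarith)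
  refine (pow_le_pow_left₀ (by positivity) hbase 2).trans ?_
  exact le_mul_of_one_le_right (sq_nonneg _) (by linarith)

theorem momentBound_nonneg {σ p γ θ : ℝ} (hp : 0 < p) (hγ : 0 < γ) (hθ : 0 < θ) {R : ℕ}
    (hM : 2 / (p * θ * γ) < (M : ℝ)) : 0 ≤ momentBound σ p γ θ M R := by
  rw [div_lt_iff₀ (by positivity)] at hM
  have hfac : 0 ≤ 2 / (p * θ * γ * M - 2) := div_nonneg zero_le_two (by linarith)
  exact mul_nonneg (sq_nonneg _) (by linarith)

theorem map_neg_pi {V ι : Type*} [Fintype ι] [MeasurableSpace V] [AddGroup V] [MeasurableNeg V]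
    {ρ : Measure V} [IsProbabilityMeasure ρ] (hsymm : ρ.map (fun v => -v) = ρ) :
    (Measure.pi fun _ : ι => ρ).map (fun a => -a) = Measure.pi fun _ : ι => ρ := by
  have : IsProbabilityMeasure (ρ.map fun v => -v) := by rwa [hsymm]
  have h := Measure.pi_map_pi (μ := fun _ : ι => ρ) (f := fun _ v => -v)
    fun _ => measurable_neg.aemeasurable
  simp_rw [hsymm] at h
  exact h

/-- The product law is invariant under negation and the medoid is odd, so the integral equals its
own negative. -/
theorem integral_medoid_eq_zero {argmin : (Fin M → ℝ) → Fin M}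
    (ρ : Measure (EuclideanSpace ℝ (Fin d))) [IsProbabilityMeasure ρ]
    (hsymm : ρ.map (fun v => -v) = ρ) :
    ∫ a, medoid argmin a ∂(Measure.pi fun _ : Fin M => ρ) = 0 := by
  have hneg : ∫ a, medoid argmin a ∂(Measure.pi fun _ : Fin M => ρ) =
      -∫ a, medoid argmin a ∂(Measure.pi fun _ : Fin M => ρ) := by
    conv_lhs => rw [← map_neg_pi hsymm]
    rw [show (fun (a : Fin M → EuclideanSpace ℝ (Fin d)) => -a) =
      MeasurableEquiv.neg (Fin M → EuclideanSpace ℝ (Fin d)) from rfl, integral_map_equiv,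
      ← integral_neg]
    exact integral_congr_ae (.of_forall fun a => medoid_neg argmin a)
  have htwo : (2 : ℝ) • ∫ a, medoid argmin a ∂(Measure.pi fun _ : Fin M => ρ) = 0 := by
    rw [two_smul]
    exact eq_neg_iff_add_eq_zero.1 hneg
  exact (smul_eq_zero.1 htwo).resolve_left two_ne_zero

end MedoidMoment

/-! ### The law of a chunk average -/

section Averages

variable {V : Type*} [NormedAddCommGroup V] [InnerProductSpace ℝ V] [MeasurableSpace V]
  [BorelSpace V] [SecondCountableTopology V]

/-- The law of the average of `R` independent vectors with law `N`. -/
def averageLaw (N : Measure V) (R : ℕ) : Measure V :=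
  (Measure.pi fun _ : Fin R => N).map fun w => (R : ℝ)⁻¹ • ∑ k, w k

theorem measurable_average (R : ℕ) : Measurable fun w : Fin R → V => (R : ℝ)⁻¹ • ∑ k, w k := by
  fun_prop

instance (N : Measure V) [IsProbabilityMeasure N] (R : ℕ) :
    IsProbabilityMeasure (averageLaw N R) :=
  Measure.isProbabilityMeasure_map (measurable_average R).aemeasurable

theorem map_neg_averageLaw {N : Measure V} [IsProbabilityMeasure N]
    (hsymm : N.map (fun v => -v) = N) (R : ℕ) :
    (averageLaw N R).map (fun v => -v) = averageLaw N R := by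
  have h : (fun v : V => -v) ∘ (fun w : Fin R → V => (R : ℝ)⁻¹ • ∑ k, w k) =
      (fun w : Fin R → V => (R : ℝ)⁻¹ • ∑ k, w k) ∘ fun w => -w := by
    ext w
    simp
  rw [averageLaw, Measure.map_map measurable_neg (measurable_average R), h,
    ← Measure.map_map (measurable_average R) measurable_neg, map_neg_pi hsymm]

/-- The sum has $p$-th moment at most $R\sigma^p$, and averaging multiplies it by $R^{-p}$;
$R^{1-p}\sigma^p$ is the $p$-th power of $\sigma/R^{(p-1)/p}$. -/
theorem lintegral_enorm_rpow_averageLaw_le {N : Measure V} [IsProbabilityMeasure N]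
    (hsymm : N.map (fun v => -v) = N) {p : ℝ} (hp0 : 0 < p) (hp2 : p ≤ 2) {σ : ℝ} (hσ : 0 ≤ σ)
    (hN : ∫⁻ v, ‖v‖ₑ ^ p ∂N ≤ ENNReal.ofReal (σ ^ p)) {R : ℕ} (hR : 1 ≤ R) :
    ∫⁻ v, ‖v‖ₑ ^ p ∂(averageLaw N R) ≤
      ENNReal.ofReal (σ / (R : ℝ) ^ ((p - 1) / p)) ^ p := by
  have hR0 : (0 : ℝ) < R := by exact_mod_cast hR
  have hmeas : Measurable fun v : V => ‖v‖ₑ ^ p := by fun_prop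
  have hmap : ∀ k : Fin R, (Measure.pi fun _ : Fin R => N).map (fun w => w k) = N :=
    fun k => (measurePreserving_eval (fun _ : Fin R => N) k).map_eq
  have hsum : ∫⁻ w, ‖∑ k, w k‖ₑ ^ p ∂(Measure.pi fun _ : Fin R => N) ≤
      R * ENNReal.ofReal (σ ^ p) := by
    refine (lintegral_enorm_sum_rpow_le_of_symm hp0 hp2 (Y := fun (k : Fin R) (w : Fin R → V) => w k)
      (fun k => measurable_pi_apply k) (iIndepFun_pi (X := fun _ v => v)
      fun _ => aemeasurable_id) (fun k => ?_) Finset.univ).trans ?_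
    · have h := Measure.map_map (μ := Measure.pi fun _ : Fin R => N) (measurable_neg (G := V))
        (measurable_pi_apply k)
      rw [hmap] at h
      rw [hmap]
      exact hsymm.symm.trans h
    · refine (Finset.sum_le_card_nsmul _ _ (ENNReal.ofReal (σ ^ p)) fun k _ => ?_).trans_eq ?_
      · rwa [(measurePreserving_eval (fun _ : Fin R => N) k).lintegral_comp hmeas]
      · simp
  rw [averageLaw, lintegral_map hmeas (measurable_average R)]
  simp_rw [enorm_smul, ENNReal.mul_rpow_of_nonneg _ _ hp0.le]
  rw [lintegral_const_mul _ (by fun_prop)]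
  calc ‖(R : ℝ)⁻¹‖ₑ ^ p * ∫⁻ w, ‖∑ k, w k‖ₑ ^ p ∂(Measure.pi fun _ : Fin R => N)
      ≤ ‖(R : ℝ)⁻¹‖ₑ ^ p * (R * ENNReal.ofReal (σ ^ p)) := by gcongr
    _ = ENNReal.ofReal ((R : ℝ)⁻¹ ^ p * (R * σ ^ p)) := by
        rw [ENNReal.ofReal_mul (by positivity), ENNReal.ofReal_mul (by positivity),
          ENNReal.ofReal_natCast, Real.enorm_of_nonneg (by positivity),
          ENNReal.ofReal_rpow_of_nonneg (by positivity) hp0.le]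
    _ = ENNReal.ofReal ((σ / (R : ℝ) ^ ((p - 1) / p)) ^ p) := by
        congr 1
        rw [Real.div_rpow hσ (by positivity), ← Real.rpow_mul hR0.le, div_mul_cancel₀ _ hp0.ne',
          Real.rpow_sub hR0, Real.rpow_one, Real.inv_rpow hR0.le]
        field_simp
    _ = _ := by rw [ENNReal.ofReal_rpow_of_nonneg (by positivity) hp0.le]

end Averages

/-! ### The noise of one step at a fixed point -/

section Noise

variable {d : ℕ} {Ξ : Type*} [MeasurableSpace Ξ] {M R : ℕ}
  {f : EuclideanSpace ℝ (Fin d) → Ξ → ℝ} {P : Measure Ξ}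

/-- The noise of the medoid of the chunk gradients. -/
def medoidNoise (f : EuclideanSpace ℝ (Fin d) → Ξ → ℝ) (P : Measure Ξ)
    (argmin : (Fin M → ℝ) → Fin M) (x : EuclideanSpace ℝ (Fin d)) (batch : Fin M → Fin R → Ξ) :
    EuclideanSpace ℝ (Fin d) :=
  medoid argmin fun j => (R : ℝ)⁻¹ • ∑ k, gradNoise f P x (batch j k)

theorem chunkGrad_eq_average_add (hR : 1 ≤ R) (z : Fin R → Ξ) (x : EuclideanSpace ℝ (Fin d)) :
    chunkGrad f z x =
      (R : ℝ)⁻¹ • ∑ k, gradNoise f P x (z k) + gradient (populationLoss f P) x := by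
  have hR0 : (R : ℝ) ≠ 0 := by
    have : R ≠ 0 := by omega
    exact_mod_cast this
  simp only [chunkGrad, gradNoise, Finset.sum_sub_distrib, Finset.sum_const, Finset.card_univ,
    Fintype.card_fin]
  rw [smul_sub, ← Nat.cast_smul_eq_nsmul ℝ, smul_smul, inv_mul_cancel₀ hR0, one_smul,
    sub_add_cancel]

/-- All chunk gradients share the shift $\nabla F(x)$, which does not affect the selected index and
so splits off from the noise. -/
theorem step_eq (hR : 1 ≤ R) (argmin : (Fin M → ℝ) → Fin M) (α : ℝ)
    (batch : Fin M → Fin R → Ξ) (x : EuclideanSpace ℝ (Fin d)) :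
    step f argmin α batch x =
      x - α • (gradient (populationLoss f P) x + medoidNoise f P argmin x batch) := by
  simp only [step, chunkGrad_eq_average_add (P := P) hR, medoidIndex_add_const]
  rw [medoidNoise, medoid, add_comm]

theorem iterate_succ_eq {Ω : Type*} {ξ : ℕ → Fin M → Fin R → Ω → Ξ}
    {argmin : (Fin M → ℝ) → Fin M} (hR : 1 ≤ R) (x₀ : EuclideanSpace ℝ (Fin d)) (α : ℝ) (t : ℕ) (ω : Ω) :
    iterate f argmin ξ x₀ α (t + 1) ω = iterate f argmin ξ x₀ α t ω -
      α • (gradient (populationLoss f P) (iterate f argmin ξ x₀ α t ω) +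
        medoidNoise f P argmin (iterate f argmin ξ x₀ α t ω) fun j k => ξ t j k ω) :=
  step_eq hR argmin α _ _

theorem IsLSmooth.continuous_gradient {F : EuclideanSpace ℝ (Fin d) → ℝ} {L : ℝ}
    (h : IsLSmooth L F) : Continuous (gradient F) :=
  (LipschitzWith.of_dist_le' (K := L) fun x y => by
    simpa [dist_eq_norm] using h.lipschitz x y).continuous

theorem measurable_gradNoise (hf : IsStochasticLoss f P)
    (hF : Measurable (gradient (populationLoss f P))) :
    Measurable fun z : EuclideanSpace ℝ (Fin d) × Ξ => gradNoise f P z.1 z.2 :=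
  hf.measurable_grad.sub (hF.comp measurable_fst)

theorem measurable_medoidNoise (hf : IsStochasticLoss f P)
    (hF : Measurable (gradient (populationLoss f P))) {argmin : (Fin M → ℝ) → Fin M}
    (hargmin : IsArgminRule argmin) :
    Measurable fun z : EuclideanSpace ℝ (Fin d) × (Fin M → Fin R → Ξ) =>
      medoidNoise f P argmin z.1 z.2 := by
  refine (measurable_medoid hargmin).comp (measurable_pi_lambda _ fun j => ?_)
  have hsum : Measurable fun z : EuclideanSpace ℝ (Fin d) × (Fin M → Fin R → Ξ) =>
      ∑ k, gradNoise f P z.1 (z.2 j k) := Finset.measurable_fun_sum _ fun k _ =>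
    (measurable_gradNoise hf hF).comp (measurable_fst.prodMk (by fun_prop))
  exact hsum.const_smul (R : ℝ)⁻¹

/-- The law of a batch of `M` chunks of `R` independent data points each. -/
def batchLaw (P : Measure Ξ) (M R : ℕ) : Measure (Fin M → Fin R → Ξ) :=
  Measure.pi fun _ => Measure.pi fun _ => P

instance [IsProbabilityMeasure P] : IsProbabilityMeasure (batchLaw P M R) := by
  unfold batchLaw
  infer_instance

/-- Carries the results on medoids of i.i.d. vectors over to batches of data points. -/
theorem map_batchLaw_average [IsProbabilityMeasure P] {g : Ξ → EuclideanSpace ℝ (Fin d)}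
    (hg : Measurable g) :
    (batchLaw P M R).map (fun b j => (R : ℝ)⁻¹ • ∑ k, g (b j k)) =
      Measure.pi fun _ : Fin M => averageLaw (P.map g) R := by
  have : IsProbabilityMeasure (P.map g) := Measure.isProbabilityMeasure_map hg.aemeasurable
  have hinner : (Measure.pi fun _ : Fin R => P).map
      (fun z => (R : ℝ)⁻¹ • ∑ k, g (z k)) = averageLaw (P.map g) R := by
    rw [averageLaw, ← Measure.pi_map_pi (μ := fun _ : Fin R => P) (f := fun _ => g)
      fun _ => hg.aemeasurable, Measure.map_map (measurable_average R) (by fun_prop)]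
    rfl
  have : IsProbabilityMeasure ((Measure.pi fun _ : Fin R => P).map
      (fun z => (R : ℝ)⁻¹ • ∑ k, g (z k))) := by
    rw [hinner]
    infer_instance
  rw [← hinner, batchLaw]
  exact Measure.pi_map_pi (μ := fun _ : Fin M => Measure.pi fun _ : Fin R => P)
    (f := fun _ z => (R : ℝ)⁻¹ • ∑ k, g (z k)) fun _ => Measurable.aemeasurable (by fun_prop)

theorem NoiseAssumption.map_neg {σ p : ℝ} (hnoise : NoiseAssumption f P σ p)
    {x : EuclideanSpace ℝ (Fin d)} (hg : Measurable (gradNoise f P x)) :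
    (P.map (gradNoise f P x)).map (fun v => -v) = P.map (gradNoise f P x) := by
  rw [Measure.map_map measurable_neg hg, hnoise.symmetric x]
  rfl

theorem NoiseAssumption.lintegral_le {σ p : ℝ} (hp : 0 ≤ p) (hnoise : NoiseAssumption f P σ p)
    {x : EuclideanSpace ℝ (Fin d)} (hg : Measurable (gradNoise f P x)) :
    ∫⁻ v, ‖v‖ₑ ^ p ∂(P.map (gradNoise f P x)) ≤ ENNReal.ofReal (σ ^ p) := by
  rw [lintegral_map (by fun_prop) hg]
  refine le_trans (le_of_eq ?_) (ENNReal.ofReal_le_ofReal (hnoise.moment_le x))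
  rw [ofReal_integral_eq_lintegral_ofReal (hnoise.integrable_moment x)
    (.of_forall fun _ => by positivity)]
  refine lintegral_congr fun ξ => ?_
  rw [← ENNReal.ofReal_rpow_of_nonneg (norm_nonneg _) hp, ofReal_norm]

theorem lintegral_enorm_medoidNoise_sq_le [IsProbabilityMeasure P] (hf : IsStochasticLoss f P)
    (hF : Measurable (gradient (populationLoss f P))) {argmin : (Fin M → ℝ) → Fin M}
    (hargmin : IsArgminRule argmin) {σ p γ θ : ℝ} (hσ : 0 < σ) (hp : 0 < p) (hp2 : p ≤ 2)
    (hnoise : NoiseAssumption f P σ p) (hγ : γ ∈ Set.Ioo (0 : ℝ) (1 / 2))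
    (hθ : θ ∈ Set.Ioo (0 : ℝ) 1) (hM : 2 / (p * θ * γ) < (M : ℝ)) (hR : 1 ≤ R)
    (x : EuclideanSpace ℝ (Fin d)) :
    ∫⁻ b, ‖medoidNoise f P argmin x b‖ₑ ^ 2 ∂(batchLaw P M R) ≤
      ENNReal.ofReal (momentBound σ p γ θ M R) := by
  have hg : Measurable (gradNoise f P x) := (measurable_gradNoise hf hF).of_uncurry_left
  have : IsProbabilityMeasure (P.map (gradNoise f P x)) :=
    Measure.isProbabilityMeasure_map hg.aemeasurable
  have h := lintegral_enorm_medoid_sq_le_momentBound hargmin hσ hp hγ hθ hM hR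
    (averageLaw (P.map (gradNoise f P x)) R)
    (lintegral_enorm_rpow_averageLaw_le (hnoise.map_neg hg) hp hp2 hσ.le
      (hnoise.lintegral_le hp.le hg) hR)
  rwa [← map_batchLaw_average hg, lintegral_map (by
    have := measurable_medoid (d := d) hargmin
    fun_prop) (by fun_prop)] at h

theorem integral_medoidNoise_eq_zero [IsProbabilityMeasure P] (hf : IsStochasticLoss f P)
    (hF : Measurable (gradient (populationLoss f P))) {argmin : (Fin M → ℝ) → Fin M}
    (hargmin : IsArgminRule argmin) {σ p : ℝ} (hnoise : NoiseAssumption f P σ p)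
    (x : EuclideanSpace ℝ (Fin d)) :
    ∫ b, medoidNoise f P argmin x b ∂(batchLaw P M R) = 0 := by
  have hg : Measurable (gradNoise f P x) := (measurable_gradNoise hf hF).of_uncurry_left
  have : IsProbabilityMeasure (P.map (gradNoise f P x)) :=
    Measure.isProbabilityMeasure_map hg.aemeasurable
  have h := integral_medoid_eq_zero (M := M) (argmin := argmin)
    (averageLaw (P.map (gradNoise f P x)) R) (map_neg_averageLaw (hnoise.map_neg hg) R)
  rwa [← map_batchLaw_average hg, integral_map (Measurable.aemeasurable (by fun_prop))
    (measurable_medoid hargmin).aestronglyMeasurable] at h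

end Noise

/-! ### Independence of the iterate and the fresh batch -/

section Sampling

variable {d : ℕ} {Ξ Ω : Type*} [MeasurableSpace Ξ] [MeasurableSpace Ω] {M R : ℕ}
  {f : EuclideanSpace ℝ (Fin d) → Ξ → ℝ} {P : Measure Ξ} {μ : Measure Ω}
  {ξ : ℕ → Fin M → Fin R → Ω → Ξ}

theorem map_curry_pi [IsProbabilityMeasure P] :
    (Measure.pi fun _ : Fin M × Fin R => P).map Function.curry = batchLaw P M R := by
  have h : (Measure.pi fun _ : Fin M × Fin R => P) =
      (batchLaw P M R).map Function.uncurry := by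
    refine Measure.pi_eq fun s hs => ?_
    have hpre : Function.uncurry ⁻¹' (Set.univ.pi s) =
        Set.univ.pi fun j : Fin M => Set.univ.pi fun k : Fin R => s (j, k) := by
      ext b
      simp [Set.mem_pi]
    rw [Measure.map_apply measurable_uncurry (MeasurableSet.univ_pi hs), hpre, batchLaw,
      Measure.pi_pi, Fintype.prod_prod_type]
    simp_rw [Measure.pi_pi]
  rw [h, Measure.map_map measurable_curry measurable_uncurry]
  exact Measure.map_id

theorem IsIIDSample.map_batch [IsProbabilityMeasure P] [IsProbabilityMeasure μ]
    (hξ : IsIIDSample ξ P μ) (t : ℕ) :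
    μ.map (fun ω j k => ξ t j k ω) = batchLaw P M R := by
  have hind : iIndepFun (fun (i : Fin M × Fin R) => ξ t i.1 i.2) μ :=
    hξ.indep.precomp (g := fun i : Fin M × Fin R => (t, i)) (Prod.mk_right_injective t)
  have hlaw := (iIndepFun_iff_map_fun_eq_pi_map
    fun i : Fin M × Fin R => (hξ.measurable t i.1 i.2).aemeasurable).1 hind
  simp_rw [hξ.law] at hlaw
  rw [← map_curry_pi, ← hlaw, Measure.map_map measurable_curry
    (measurable_pi_lambda _ fun i => hξ.measurable t i.1 i.2)]
  rfl

theorem measurable_batch {α : Type*} {_ : MeasurableSpace α} {z : Fin M → Fin R → α → Ξ}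
    (hz : ∀ j k, Measurable (z j k)) : Measurable fun a j k => z j k a :=
  measurable_pi_lambda _ fun j => measurable_pi_lambda _ fun k => hz j k

theorem measurable_step (hf : IsStochasticLoss f P)
    (hF : Measurable (gradient (populationLoss f P))) {argmin : (Fin M → ℝ) → Fin M}
    (hargmin : IsArgminRule argmin) (hR : 1 ≤ R) (α : ℝ) :
    Measurable fun z : EuclideanSpace ℝ (Fin d) × (Fin M → Fin R → Ξ) =>
      step f argmin α z.2 z.1 := by
  simp_rw [step_eq (P := P) hR]
  have := measurable_medoidNoise (R := R) hf hF hargmin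
  fun_prop

/-- The iterate `x^t` is a function of the data points drawn before iteration `t`. -/
theorem measurable_iterate_past {Ω : Type*} {ξ : ℕ → Fin M → Fin R → Ω → Ξ}
    (hf : IsStochasticLoss f P)
    (hF : Measurable (gradient (populationLoss f P))) {argmin : (Fin M → ℝ) → Fin M}
    (hargmin : IsArgminRule argmin) (hR : 1 ≤ R) (x₀ : EuclideanSpace ℝ (Fin d)) (α : ℝ) (t : ℕ) :
    Measurable[⨆ i ∈ {i : ℕ × Fin M × Fin R | i.1 < t},
      MeasurableSpace.comap (ξ i.1 i.2.1 i.2.2) inferInstance]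
      (iterate f argmin ξ x₀ α t) := by
  induction t with
  | zero => exact measurable_const
  | succ t ih =>
    refine (measurable_step hf hF hargmin hR α).comp (Measurable.prodMk (ih.mono ?_ le_rfl) ?_)
    · exact biSup_mono fun i (hi : i.1 < t) => Nat.lt_succ_of_lt hi
    · refine measurable_batch fun j k => ?_
      refine measurable_iff_comap_le.2 ?_
      exact le_biSup (fun i : ℕ × Fin M × Fin R =>
        MeasurableSpace.comap (ξ i.1 i.2.1 i.2.2) inferInstance)
        (show (t, j, k) ∈ {i : ℕ × Fin M × Fin R | i.1 < t + 1} from Nat.lt_succ_self t)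

theorem measurable_iterate (hξ : IsIIDSample ξ P μ) (hf : IsStochasticLoss f P)
    (hF : Measurable (gradient (populationLoss f P))) {argmin : (Fin M → ℝ) → Fin M}
    (hargmin : IsArgminRule argmin) (hR : 1 ≤ R) (x₀ : EuclideanSpace ℝ (Fin d)) (α : ℝ) (t : ℕ) :
    Measurable (iterate f argmin ξ x₀ α t) :=
  (measurable_iterate_past hf hF hargmin hR x₀ α t).mono
    (iSup₂_le fun _ _ => (hξ.measurable _ _ _).comap_le) le_rfl

/-- The iterate uses only samples with time index below $t$, the batch only those with index $t$;
disjoint subfamilies of an independent family are independent. -/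
theorem indepFun_iterate_batch (hξ : IsIIDSample ξ P μ) (hf : IsStochasticLoss f P)
    (hF : Measurable (gradient (populationLoss f P))) {argmin : (Fin M → ℝ) → Fin M}
    (hargmin : IsArgminRule argmin) (hR : 1 ≤ R) (x₀ : EuclideanSpace ℝ (Fin d)) (α : ℝ) (t : ℕ) :
    IndepFun (iterate f argmin ξ x₀ α t) (fun ω j k => ξ t j k ω) μ := by
  have hdisj : Disjoint {i : ℕ × Fin M × Fin R | i.1 < t} {i : ℕ × Fin M × Fin R | i.1 = t} :=
    Set.disjoint_left.2 fun i (hi : i.1 < t) (hi' : i.1 = t) => hi.ne hi'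
  have hind := indep_iSup_of_disjoint (fun i => (hξ.measurable _ _ _).comap_le)
    ((iIndepFun_iff_iIndep _ _ μ).1 hξ.indep) hdisj
  rw [IndepFun_iff_Indep]
  refine indep_of_indep_of_le_left (indep_of_indep_of_le_right hind ?_)
    (measurable_iff_comap_le.1 (measurable_iterate_past hf hF hargmin hR x₀ α t))
  rw [← measurable_iff_comap_le]
  refine measurable_batch fun j k => ?_
  refine measurable_iff_comap_le.2 ?_
  exact le_biSup (fun i : ℕ × Fin M × Fin R =>
    MeasurableSpace.comap (ξ i.1 i.2.1 i.2.2) inferInstance)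
    (show (t, j, k) ∈ {i : ℕ × Fin M × Fin R | i.1 = t} from rfl)

variable [IsProbabilityMeasure μ] {X : Ω → EuclideanSpace ℝ (Fin d)} {Z : Ω → Fin M → Fin R → Ξ}

theorem map_prodMk_batch (hX : Measurable X) (hZ : Measurable Z) (hXZ : IndepFun X Z μ)
    (hlaw : μ.map Z = batchLaw P M R) :
    μ.map (fun ω => (X ω, Z ω)) = (μ.map X).prod (batchLaw P M R) := by
  rw [(indepFun_iff_map_prod_eq_prod_map_map hX.aemeasurable hZ.aemeasurable).1 hXZ, hlaw]

variable [IsProbabilityMeasure P]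

/-- The joint law of point and batch is a product, so a bound valid at every fixed point survives
integration over a random one. -/
theorem lintegral_enorm_medoidNoise_comp_sq_le (hf : IsStochasticLoss f P)
    (hF : Measurable (gradient (populationLoss f P))) {argmin : (Fin M → ℝ) → Fin M}
    (hargmin : IsArgminRule argmin) (hX : Measurable X) (hZ : Measurable Z)
    (hXZ : IndepFun X Z μ) (hlaw : μ.map Z = batchLaw P M R) {B : ℝ≥0∞}
    (hB : ∀ x, ∫⁻ b, ‖medoidNoise f P argmin x b‖ₑ ^ 2 ∂(batchLaw P M R) ≤ B) :
    ∫⁻ ω, ‖medoidNoise f P argmin (X ω) (Z ω)‖ₑ ^ 2 ∂μ ≤ B := by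
  have hmeas : Measurable fun z : EuclideanSpace ℝ (Fin d) × (Fin M → Fin R → Ξ) =>
      ‖medoidNoise f P argmin z.1 z.2‖ₑ ^ 2 :=
    (measurable_medoidNoise hf hF hargmin).enorm.pow_const 2
  have : IsProbabilityMeasure (μ.map X) := Measure.isProbabilityMeasure_map hX.aemeasurable
  rw [← lintegral_map (μ := μ) hmeas (hX.prodMk hZ), map_prodMk_batch hX hZ hXZ hlaw,
    lintegral_prod _ hmeas.aemeasurable]
  exact (lintegral_mono fun x => hB x).trans_eq (by simp)

theorem memLp_two_of_lintegral_le {α V : Type*} [MeasurableSpace α] {ν : Measure α}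
    [NormedAddCommGroup V] {g : α → V} (hg : AEStronglyMeasurable g ν) {B : ℝ}
    (hB : ∫⁻ a, ‖g a‖ₑ ^ 2 ∂ν ≤ ENNReal.ofReal B) : MemLp g 2 ν := by
  rw [memLp_two_iff_integrable_sq_norm hg]
  refine ⟨(hg.norm.pow 2), ?_⟩
  rw [hasFiniteIntegral_iff_enorm]
  refine lt_of_le_of_lt ?_ (hB.trans_lt ENNReal.ofReal_lt_top)
  refine le_of_eq (lintegral_congr fun a => ?_)
  simp

theorem integral_norm_sq_le_of_lintegral_le {α V : Type*} [MeasurableSpace α] {ν : Measure α}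
    [NormedAddCommGroup V] {g : α → V} (hg : AEStronglyMeasurable g ν) {B : ℝ} (hB0 : 0 ≤ B)
    (hB : ∫⁻ a, ‖g a‖ₑ ^ 2 ∂ν ≤ ENNReal.ofReal B) : ∫ a, ‖g a‖ ^ 2 ∂ν ≤ B := by
  rw [integral_eq_lintegral_of_nonneg_ae (f := fun a => ‖g a‖ ^ 2)
    (.of_forall fun _ => by positivity) (hg.norm.pow 2)]
  refine ENNReal.toReal_le_of_le_ofReal hB0 (le_trans (le_of_eq ?_) hB)
  refine lintegral_congr fun a => ?_
  rw [ENNReal.ofReal_pow (norm_nonneg _), ofReal_norm]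

theorem integrable_inner_of_memLp_two {α V : Type*} [MeasurableSpace α] {ν : Measure α}
    [NormedAddCommGroup V] [InnerProductSpace ℝ V] {g h : α → V} (hg : MemLp g 2 ν)
    (hh : MemLp h 2 ν) : Integrable (fun a => inner ℝ (g a) (h a)) ν :=
  (hg.norm.integrable_mul hh.norm).mono' (hg.1.inner hh.1)
    (.of_forall fun a => norm_inner_le_norm (g a) (h a))

/-- By Fubini the batch can be integrated first, at fixed $x$, where the noise has mean zero. Both
factors lie in $L^2$, which makes the inner product integrable. -/
theorem integral_inner_medoidNoise_eq_zero (hf : IsStochasticLoss f P)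
    (hF : Measurable (gradient (populationLoss f P))) {argmin : (Fin M → ℝ) → Fin M}
    (hargmin : IsArgminRule argmin) {σ p : ℝ} (hnoise : NoiseAssumption f P σ p)
    (hX : Measurable X) (hZ : Measurable Z)
    (hXZ : IndepFun X Z μ) (hlaw : μ.map Z = batchLaw P M R) {B : ℝ}
    (hB : ∀ x, ∫⁻ b, ‖medoidNoise f P argmin x b‖ₑ ^ 2 ∂(batchLaw P M R) ≤ ENNReal.ofReal B)
    {g : EuclideanSpace ℝ (Fin d) → EuclideanSpace ℝ (Fin d)} (hg : Measurable g)
    (hgX : MemLp (fun ω => g (X ω)) 2 μ) :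
    ∫ ω, inner ℝ (g (X ω)) (medoidNoise f P argmin (X ω) (Z ω)) ∂μ = 0 := by
  have hnm := measurable_medoidNoise (R := R) hf hF hargmin
  have : IsProbabilityMeasure (μ.map X) := Measure.isProbabilityMeasure_map hX.aemeasurable
  have hmeas : Measurable fun z : EuclideanSpace ℝ (Fin d) × (Fin M → Fin R → Ξ) =>
      inner ℝ (g z.1) (medoidNoise f P argmin z.1 z.2) :=
    (hg.comp measurable_fst).inner hnm
  have hint : Integrable (fun ω => inner ℝ (g (X ω)) (medoidNoise f P argmin (X ω) (Z ω))) μ :=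
    integrable_inner_of_memLp_two hgX (memLp_two_of_lintegral_le
      (hnm.comp (hX.prodMk hZ)).aestronglyMeasurable
      (lintegral_enorm_medoidNoise_comp_sq_le hf hF hargmin hX hZ hXZ hlaw hB))
  have hint' : Integrable (fun z : EuclideanSpace ℝ (Fin d) × (Fin M → Fin R → Ξ) =>
      inner ℝ (g z.1) (medoidNoise f P argmin z.1 z.2)) ((μ.map X).prod (batchLaw P M R)) := by
    rw [← map_prodMk_batch hX hZ hXZ hlaw]
    exact (integrable_map_measure hmeas.aestronglyMeasurable
      (hX.prodMk hZ).aemeasurable).2 hint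
  have hmap := integral_map (μ := μ) (hX.prodMk hZ).aemeasurable hmeas.aestronglyMeasurable
  rw [map_prodMk_batch hX hZ hXZ hlaw, integral_prod _ hint'] at hmap
  rw [← hmap]
  refine (integral_congr_ae (.of_forall fun x => ?_)).trans (integral_zero' _ _)
  have hix : Integrable (fun b => medoidNoise f P argmin x b) (batchLaw P M R) :=
    (memLp_two_of_lintegral_le (hnm.of_uncurry_left (x := x)).aestronglyMeasurable
      (hB x)).integrable one_le_two
  simp only [Pi.zero_apply]
  rw [integral_inner hix, integral_medoidNoise_eq_zero hf hF hargmin hnoise, inner_zero_right]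

end Sampling

/-! ### Descent inequality for smooth functions -/

section Descent

variable {d : ℕ}

/-- Along $t\mapsto x+tv$ on $[0,1]$, $F$ and the quadratic agree at $t=0$, and Cauchy–Schwarz with
the Lipschitz bound makes the derivative of $F$ the smaller one. -/
theorem IsLSmooth.le_quadratic {F : EuclideanSpace ℝ (Fin d) → ℝ} {L : ℝ} (h : IsLSmooth L F)
    (x v : EuclideanSpace ℝ (Fin d)) :
    F (x + v) ≤ F x + inner ℝ (gradient F x) v + L / 2 * ‖v‖ ^ 2 := by
  have hder : ∀ t : ℝ, HasDerivAt (fun t : ℝ => F (x + t • v))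
      (inner ℝ (gradient F (x + t • v)) v) t := fun t => by
    have hline : HasDerivAt (fun t : ℝ => x + t • v) v t := by
      simpa using ((hasDerivAt_id t).smul_const v).const_add x
    have hgrad := ((h.differentiable (x + t • v)).hasGradientAt).hasFDerivAt
    refine (hgrad.comp_hasDerivAt t hline).congr_deriv ?_
    exact InnerProductSpace.toDual_apply_apply
  have hquad : ∀ t : ℝ, HasDerivAt
      (fun t : ℝ => F x + t * inner ℝ (gradient F x) v + L / 2 * t ^ 2 * ‖v‖ ^ 2)
      (inner ℝ (gradient F x) v + L * t * ‖v‖ ^ 2) t := fun t => by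
    have h1 := ((hasDerivAt_id t).mul_const (inner ℝ (gradient F x) v)).const_add (F x)
    have h2 := (((hasDerivAt_id t).pow 2).const_mul (L / 2)).mul_const (‖v‖ ^ 2)
    refine (h1.add h2).congr_deriv ?_
    simp only [id, Nat.cast_ofNat]
    ring
  have hle := image_le_of_deriv_right_le_deriv_boundary (a := 0) (b := 1)
    (fun t _ => (hder t).continuousAt.continuousWithinAt)
    (fun t _ => (hder t).hasDerivWithinAt) (by simp)
    (fun t _ => (hquad t).continuousAt.continuousWithinAt)
    (fun t _ => (hquad t).hasDerivWithinAt) (fun t ht => ?_) (Set.right_mem_Icc.2 zero_le_one)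
  · simpa using hle
  · have hcs := real_inner_le_norm (gradient F (x + t • v) - gradient F x) v
    have hlip := h.lipschitz (x + t • v) x
    rw [add_sub_cancel_left, norm_smul, Real.norm_of_nonneg ht.1] at hlip
    rw [inner_sub_left] at hcs
    nlinarith [mul_le_mul_of_nonneg_right hlip (norm_nonneg v)]

variable {Ω : Type*} [MeasurableSpace Ω] {μ : Measure Ω} [IsProbabilityMeasure μ]
  {X : Ω → EuclideanSpace ℝ (Fin d)} {F : EuclideanSpace ℝ (Fin d) → ℝ} {L : ℝ}

theorem IsLSmooth.memLp_gradient (h : IsLSmooth L F) (hX : MemLp X 2 μ) :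
    MemLp (fun ω => gradient F (X ω)) 2 μ := by
  refine MemLp.mono' ((memLp_const ‖gradient F 0‖).add (hX.norm.const_mul L))
    (h.continuous_gradient.comp_aestronglyMeasurable hX.1) (.of_forall fun ω => ?_)
  have h1 := norm_le_norm_add_norm_sub' (gradient F (X ω)) (gradient F 0)
  have h2 := h.lipschitz (X ω) 0
  rw [sub_zero] at h2
  simp only [Pi.add_apply]
  linarith

/-- $F$ is squeezed between a constant and a quadratic, so square integrability of $X$ suffices. -/
theorem IsLSmooth.integrable_comp (h : IsLSmooth L F) {Fmin : ℝ} (hFmin : ∀ x, Fmin ≤ F x)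
    (hX : MemLp X 2 μ) : Integrable (fun ω => F (X ω)) μ := by
  have hup : Integrable
      (fun ω => F 0 + inner ℝ (gradient F 0) (X ω) + L / 2 * ‖X ω‖ ^ 2) μ :=
    ((integrable_const _).add (integrable_inner_of_memLp_two (memLp_const _) hX)).add
      (((memLp_two_iff_integrable_sq_norm hX.1).1 hX).const_mul _)
  refine integrable_of_le_of_le (h.differentiable.continuous.comp_aestronglyMeasurable hX.1)
    (.of_forall fun ω => hFmin (X ω)) (.of_forall fun ω => ?_) (integrable_const Fmin) hup
  simpa using h.le_quadratic 0 (X ω)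

theorem IsLSmooth.integral_comp_step_le (h : IsLSmooth L F) (hL : 0 ≤ L) {Fmin : ℝ}
    (hFmin : ∀ x, Fmin ≤ F x) (hX : MemLp X 2 μ) {N : Ω → EuclideanSpace ℝ (Fin d)}
    (hN : MemLp N 2 μ) {B : ℝ} (hB : ∫ ω, ‖N ω‖ ^ 2 ∂μ ≤ B)
    (hmean : ∫ ω, inner ℝ (gradient F (X ω)) (N ω) ∂μ = 0) (α : ℝ) :
    ∫ ω, F (X ω - α • (gradient F (X ω) + N ω)) ∂μ ≤
      ∫ ω, F (X ω) ∂μ - α * (1 - L * α / 2) * ∫ ω, ‖gradient F (X ω)‖ ^ 2 ∂μ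
        + L * α ^ 2 / 2 * B := by
  have hG := h.memLp_gradient hX
  have hG2 := (memLp_two_iff_integrable_sq_norm hG.1).1 hG
  have hN2 := (memLp_two_iff_integrable_sq_norm hN.1).1 hN
  have hGN := integrable_inner_of_memLp_two hG hN
  have hFX := h.integrable_comp hFmin hX
  have hnext : MemLp (fun ω => X ω - α • (gradient F (X ω) + N ω)) 2 μ :=
    hX.sub ((hG.add hN).const_smul α)
  -- The quadratic bound at $v=-\alpha(\nabla F+N)$, with the square expanded and the cross terms
  -- collected; their coefficient is irrelevant because their mean is zero.
  have hpt : ∀ ω, F (X ω - α • (gradient F (X ω) + N ω)) ≤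
      F (X ω) - α * (1 - L * α / 2) * ‖gradient F (X ω)‖ ^ 2
        + ((L * α ^ 2 - α) * inner ℝ (gradient F (X ω)) (N ω)
          + L * α ^ 2 / 2 * ‖N ω‖ ^ 2) := fun ω => by
    have hq := h.le_quadratic (X ω) (-(α • (gradient F (X ω) + N ω)))
    rw [← sub_eq_add_neg, inner_neg_right, inner_smul_right, inner_add_right,
      real_inner_self_eq_norm_sq, norm_neg, norm_smul, mul_pow, norm_add_sq_real,
      Real.norm_eq_abs, sq_abs] at hq
    linarith
  have hint1 := hFX.sub (hG2.const_mul (α * (1 - L * α / 2)))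
  have hint2 := (hGN.const_mul (L * α ^ 2 - α)).add (hN2.const_mul (L * α ^ 2 / 2))
  have hmono := integral_mono (h.integrable_comp hFmin hnext) (hint1.add hint2) hpt
  refine hmono.trans ?_
  have hsplit := integral_add hint1 hint2
  have hsplit1 := integral_sub hFX (hG2.const_mul (α * (1 - L * α / 2)))
  have hsplit2 := integral_add (hGN.const_mul (L * α ^ 2 - α)) (hN2.const_mul (L * α ^ 2 / 2))
  rw [integral_const_mul] at hsplit1
  rw [integral_const_mul, integral_const_mul, hmean] at hsplit2
  have hLB : L * α ^ 2 / 2 * ∫ ω, ‖N ω‖ ^ 2 ∂μ ≤ L * α ^ 2 / 2 * B := by gcongr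
  refine (hsplit.trans (congrArg₂ (· + ·) hsplit1 hsplit2)).le.trans ?_
  linarith

end Descent

/-! ### Summation along the trajectory -/

section Convergence

variable {d : ℕ} {Ξ Ω : Type*} [MeasurableSpace Ξ] [MeasurableSpace Ω] {M R : ℕ}
  {f : EuclideanSpace ℝ (Fin d) → Ξ → ℝ} {P : Measure Ξ} [IsProbabilityMeasure P]
  {μ : Measure Ω} [IsProbabilityMeasure μ] {ξ : ℕ → Fin M → Fin R → Ω → Ξ}
  {argmin : (Fin M → ℝ) → Fin M} {L B σ p : ℝ}

theorem memLp_medoidNoise_iterate (hf : IsStochasticLoss f P)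
    (hF : Measurable (gradient (populationLoss f P))) (hargmin : IsArgminRule argmin)
    (hξ : IsIIDSample ξ P μ) (hR : 1 ≤ R)
    (hB : ∀ x, ∫⁻ b, ‖medoidNoise f P argmin x b‖ₑ ^ 2 ∂(batchLaw P M R) ≤ ENNReal.ofReal B)
    (hB0 : 0 ≤ B) (x₀ : EuclideanSpace ℝ (Fin d)) (α : ℝ) (t : ℕ) :
    MemLp (fun ω => medoidNoise f P argmin (iterate f argmin ξ x₀ α t ω)
        fun j k => ξ t j k ω) 2 μ ∧
      ∫ ω, ‖medoidNoise f P argmin (iterate f argmin ξ x₀ α t ω)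
        fun j k => ξ t j k ω‖ ^ 2 ∂μ ≤ B := by
  have hX := measurable_iterate hξ hf hF hargmin hR x₀ α t
  have hZ : Measurable fun ω j k => ξ t j k ω := measurable_batch (hξ.measurable t)
  have hle := lintegral_enorm_medoidNoise_comp_sq_le hf hF hargmin hX hZ
    (indepFun_iterate_batch hξ hf hF hargmin hR x₀ α t) (hξ.map_batch t) hB
  have hmeas := ((measurable_medoidNoise hf hF hargmin).comp
    (hX.prodMk hZ)).aestronglyMeasurable (μ := μ)
  exact ⟨memLp_two_of_lintegral_le hmeas hle, integral_norm_sq_le_of_lintegral_le hmeas hB0 hle⟩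

/-- Since $\nabla F$ grows at most linearly and the noise is in $L^2$, one step preserves $L^2$.
Only finiteness is needed, so the step size is unrestricted. -/
theorem memLp_iterate (hf : IsStochasticLoss f P) (hsmooth : IsLSmooth L (populationLoss f P))
    (hargmin : IsArgminRule argmin) (hξ : IsIIDSample ξ P μ) (hR : 1 ≤ R)
    (hB : ∀ x, ∫⁻ b, ‖medoidNoise f P argmin x b‖ₑ ^ 2 ∂(batchLaw P M R) ≤ ENNReal.ofReal B)
    (hB0 : 0 ≤ B) (x₀ : EuclideanSpace ℝ (Fin d)) (α : ℝ) (t : ℕ) :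
    MemLp (iterate f argmin ξ x₀ α t) 2 μ := by
  induction t with
  | zero => exact memLp_const x₀
  | succ t ih =>
    have hN := (memLp_medoidNoise_iterate hf hsmooth.continuous_gradient.measurable hargmin hξ hR
      hB hB0 x₀ α t).1
    have hstep := ih.sub (((hsmooth.memLp_gradient ih).add hN).const_smul α)
    exact (memLp_congr_ae (.of_forall fun ω => iterate_succ_eq hR x₀ α t ω)).2 hstep

theorem sum_integral_norm_gradient_sq_le (hf : IsStochasticLoss f P) (hL : 0 ≤ L)
    (hsmooth : IsLSmooth L (populationLoss f P)) {Fmin : ℝ}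
    (hFmin : ∀ x, Fmin ≤ populationLoss f P x) (hnoise : NoiseAssumption f P σ p)
    (hargmin : IsArgminRule argmin) (hξ : IsIIDSample ξ P μ) (hR : 1 ≤ R)
    (hB : ∀ x, ∫⁻ b, ‖medoidNoise f P argmin x b‖ₑ ^ 2 ∂(batchLaw P M R) ≤ ENNReal.ofReal B)
    (hB0 : 0 ≤ B) (x₀ : EuclideanSpace ℝ (Fin d)) (α : ℝ) (n : ℕ) :
    α * (1 - L * α / 2) * ∑ t ∈ Finset.range n,
        ∫ ω, ‖gradient (populationLoss f P) (iterate f argmin ξ x₀ α t ω)‖ ^ 2 ∂μ ≤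
      populationLoss f P x₀ - ∫ ω, populationLoss f P (iterate f argmin ξ x₀ α n ω) ∂μ
        + n * (L * α ^ 2 / 2 * B) := by
  have hF := hsmooth.continuous_gradient.measurable
  induction n with
  | zero => simp [iterate]
  | succ t ih =>
    have hXm := measurable_iterate hξ hf hF hargmin hR x₀ α t
    have hX := memLp_iterate hf hsmooth hargmin hξ hR hB hB0 x₀ α t
    obtain ⟨hN, hNB⟩ := memLp_medoidNoise_iterate hf hF hargmin hξ hR hB hB0 x₀ α t
    have hmean := integral_inner_medoidNoise_eq_zero hf hF hargmin hnoise hXm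
      (measurable_batch (hξ.measurable t)) (indepFun_iterate_batch hξ hf hF hargmin hR x₀ α t)
      (hξ.map_batch t) hB hF (hsmooth.memLp_gradient hX)
    have hstep := hsmooth.integral_comp_step_le hL hFmin hX hN hNB hmean α
    simp only [← iterate_succ_eq (P := P) hR] at hstep
    rw [Finset.sum_range_succ]
    push_cast
    linarith

theorem average_integral_norm_gradient_sq_le (hf : IsStochasticLoss f P) (hL : 0 < L)
    (hsmooth : IsLSmooth L (populationLoss f P)) {Fmin : ℝ}
    (hFmin : ∀ x, Fmin ≤ populationLoss f P x) (hnoise : NoiseAssumption f P σ p)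
    (hargmin : IsArgminRule argmin) (hξ : IsIIDSample ξ P μ) (hR : 1 ≤ R)
    (hB : ∀ x, ∫⁻ b, ‖medoidNoise f P argmin x b‖ₑ ^ 2 ∂(batchLaw P M R) ≤ ENNReal.ofReal B)
    (hB0 : 0 ≤ B) (x₀ : EuclideanSpace ℝ (Fin d)) {α : ℝ} (hα : 0 < α) (hαL : α ≤ 1 / (2 * L))
    {T : ℕ} (hT : 1 ≤ T) :
    (1 / (T : ℝ)) * ∑ t ∈ Finset.range (T + 1),
        ∫ ω, ‖gradient (populationLoss f P) (iterate f argmin ξ x₀ α t ω)‖ ^ 2 ∂μ ≤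
      2 * (populationLoss f P x₀ - Fmin) / (α * T) + 2 * L * α * B := by
  have hT' : (1 : ℝ) ≤ T := by exact_mod_cast hT
  have hT0 : (0 : ℝ) < T := by linarith
  -- The sum runs over $0,\dots,T$, hence $T+1$ descent steps, although the average divides by $T$.
  have hsum := sum_integral_norm_gradient_sq_le hf hL.le hsmooth hFmin hnoise hargmin hξ hR hB
    hB0 x₀ α (T + 1)
  have hlow : Fmin ≤ ∫ ω, populationLoss f P (iterate f argmin ξ x₀ α (T + 1) ω) ∂μ := by
    have h := integral_mono (integrable_const Fmin)
      (hsmooth.integrable_comp hFmin (memLp_iterate hf hsmooth hargmin hξ hR hB hB0 x₀ α (T + 1)))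
      fun ω => hFmin _
    simpa using h
  set S := ∑ t ∈ Finset.range (T + 1),
    ∫ ω, ‖gradient (populationLoss f P) (iterate f argmin ξ x₀ α t ω)‖ ^ 2 ∂μ with hS
  have hS0 : 0 ≤ S := Finset.sum_nonneg fun t _ => integral_nonneg fun ω => sq_nonneg _
  have hLα : L * α ≤ 1 / 2 := by
    rw [le_div_iff₀ (by positivity)] at hαL
    linarith
  -- Here $L\alpha\le1/2$ gives $1-L\alpha/2\ge3/4$, more than the $1/2$ used.
  have hcoef : α * S / 2 ≤ α * (1 - L * α / 2) * S := by
    have : 0 ≤ α * S := by positivity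
    nlinarith
  -- The extra noise term is absorbed through $(T+1)/2\le T$; this is where $T\ge1$ enters.
  have hterm : ((T + 1 : ℕ) : ℝ) * (L * α ^ 2 / 2 * B) ≤ T * (L * α ^ 2 * B) := by
    have : 0 ≤ L * α ^ 2 * B := by positivity
    push_cast
    nlinarith
  have hfinal : α * S / 2 ≤ populationLoss f P x₀ - Fmin + T * (L * α ^ 2 * B) := by linarith
  have hrhs : 2 * (populationLoss f P x₀ - Fmin) / (α * T) + 2 * L * α * B =
      2 * (populationLoss f P x₀ - Fmin + T * (L * α ^ 2 * B)) / (α * T) := by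
    field_simp
  rw [hrhs, le_div_iff₀ (by positivity)]
  calc 1 / (T : ℝ) * S * (α * T) = 2 * (α * S / 2) := by field_simp
    _ ≤ _ := by linarith

end Convergence

end RSGDMini

end

/-! ### The convergence theorem -/

theorem mainTheorem1 {d : ℕ} {Ξ Ω : Type*} [MeasurableSpace Ξ] [MeasurableSpace Ω]
    (P : MeasureTheory.Measure Ξ) [MeasureTheory.IsProbabilityMeasure P]
    (μ : MeasureTheory.Measure Ω) [MeasureTheory.IsProbabilityMeasure μ]
    (f : EuclideanSpace ℝ (Fin d) → Ξ → ℝ) (hf : RSGDMini.IsStochasticLoss f P)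
    (L : ℝ) (hL : 0 < L) (hsmooth : RSGDMini.IsLSmooth L (RSGDMini.populationLoss f P))
    (Fmin : ℝ) (hFmin : ∀ x, Fmin ≤ RSGDMini.populationLoss f P x)
    (σ p : ℝ) (hσ : 0 < σ) (hp1 : 1 < p) (hp2 : p ≤ 2)
    (hnoise : RSGDMini.NoiseAssumption f P σ p)
    (γ θ : ℝ) (hγ : γ ∈ Set.Ioo (0 : ℝ) (1 / 2)) (hθ : θ ∈ Set.Ioo (0 : ℝ) 1)
    (M R : ℕ) (hM : 2 / (p * θ * γ) < (M : ℝ)) (hR : 1 ≤ R)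
    (argmin : (Fin M → ℝ) → Fin M) (hargmin : RSGDMini.IsArgminRule argmin)
    (ξ : ℕ → Fin M → Fin R → Ω → Ξ) (hξ : RSGDMini.IsIIDSample ξ P μ)
    (x₀ : EuclideanSpace ℝ (Fin d)) :
    (∀ α : ℝ, 0 < α → α ≤ 1 / (2 * L) →
      (∀ t : ℕ, MeasureTheory.Integrable (fun ω => ‖gradient (RSGDMini.populationLoss f P)
          (RSGDMini.iterate f argmin ξ x₀ α t ω)‖ ^ 2) μ) ∧
      ∀ T : ℕ, 1 ≤ T →
        (1 / (T : ℝ)) * ∑ t ∈ Finset.range (T + 1),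
            ∫ ω, ‖gradient (RSGDMini.populationLoss f P)
              (RSGDMini.iterate f argmin ξ x₀ α t ω)‖ ^ 2 ∂μ
          ≤ 2 * (RSGDMini.populationLoss f P x₀ - Fmin) / (α * T)
            + 2 * L * α * RSGDMini.momentBound σ p γ θ M R) ∧
    (∀ a : ℝ, 0 < a →
      (fun T : ℕ => (1 / (T : ℝ)) * ∑ t ∈ Finset.range (T + 1),
          ∫ ω, ‖gradient (RSGDMini.populationLoss f P)
            (RSGDMini.iterate f argmin ξ x₀ (a * (T : ℝ) ^ (-(1 / 2) : ℝ)) t ω)‖ ^ 2 ∂μ)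
        =O[Filter.atTop] fun T : ℕ => (T : ℝ) ^ (-(1 / 2) : ℝ)) := by
  have hF := hsmooth.continuous_gradient.measurable
  have hp : 0 < p := by linarith
  have hB := RSGDMini.lintegral_enorm_medoidNoise_sq_le hf hF hargmin hσ hp hp2 hnoise hγ hθ hM hR
  have hB0 : 0 ≤ RSGDMini.momentBound σ p γ θ M R :=
    RSGDMini.momentBound_nonneg hp hγ.1 hθ.1 hM
  refine ⟨fun α hα hαL => ⟨fun t => ?_, fun T hT => ?_⟩, fun a ha => ?_⟩
  · have hG := hsmooth.memLp_gradient
      (RSGDMini.memLp_iterate hf hsmooth hargmin hξ hR hB hB0 x₀ α t)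
    exact (MeasureTheory.memLp_two_iff_integrable_sq_norm hG.1).1 hG
  · exact RSGDMini.average_integral_norm_gradient_sq_le hf hL hsmooth hFmin hnoise hargmin hξ hR
      hB hB0 x₀ hα hαL hT
  · have hlim : Filter.Tendsto (fun T : ℕ => a * (T : ℝ) ^ (-(1 / 2) : ℝ)) Filter.atTop
        (nhds 0) := by
      have h := ((tendsto_rpow_neg_atTop (y := 1 / 2) (by norm_num)).comp
        tendsto_natCast_atTop_atTop).const_mul a
      rwa [mul_zero] at h
    -- For large $T$ the step $aT^{-1/2}$ is admissible in (i). Both terms there are then exact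
    -- multiples of $T^{-1/2}$, because $1/(\alpha T)=T^{-1/2}/a$; the constant is the sum of the
    -- two coefficients.
    refine Asymptotics.IsBigO.of_bound (2 * (RSGDMini.populationLoss f P x₀ - Fmin) / a
      + 2 * L * a * RSGDMini.momentBound σ p γ θ M R) ?_
    filter_upwards [hlim.eventually_le_const (by positivity : 0 < 1 / (2 * L)),
      Filter.eventually_ge_atTop 1] with T hstep hT
    have hT0 : (0 : ℝ) < T := by exact_mod_cast hT
    have hbound := RSGDMini.average_integral_norm_gradient_sq_le hf hL hsmooth hFmin hnoise
      hargmin hξ hR hB hB0 x₀ (mul_pos ha (Real.rpow_pos_of_pos hT0 _)) hstep hT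
    rw [Real.norm_of_nonneg (mul_nonneg (by positivity) (Finset.sum_nonneg fun t _ =>
      MeasureTheory.integral_nonneg fun ω => sq_nonneg _)),
      Real.norm_of_nonneg (Real.rpow_nonneg hT0.le _)]
    refine hbound.trans_eq ?_
    have hsq : (T : ℝ) ^ (-(1 / 2) : ℝ) * (T : ℝ) ^ (-(1 / 2) : ℝ) * T = 1 := by
      rw [← Real.rpow_add hT0, ← Real.rpow_add_one hT0.ne']
      norm_num
    have hr := Real.rpow_pos_of_pos hT0 (-(1 / 2) : ℝ)
    -- With $r=T^{-1/2}$ and $T=1/r^2$ the remaining identity is rational in $r$.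
    generalize (T : ℝ) ^ (-(1 / 2) : ℝ) = r at hsq hr ⊢
    have hTr : (T : ℝ) = 1 / (r * r) := by
      field_simp
      linarith
    rw [hTr]
    field_simp
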